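/- Let $\mathbb F$ be $\mathbb R$ or $\mathbb C$ and let $\mathcal A$ be a unital $C^*$-algebra over $\mathbb F$. (For $\mathbb F=\mathbb R$ this means a real unital Banach $*$-algebra with $\|x^*x\|=\|x\|^2$ and $1+x^*x$ invertible for every $x\in\mathcal A$.) A cyclic representation $(\mathcal H,\pi,\xi)$ of $\mathcal A$ consists of a Hilbert space $\mathcal H$ over $\mathbb F$, a unital $*$-homomorphism $\pi$ from $\mathcal A$ to the bounded operators on $\mathcal H$, and a unit vector $\xi\in\mathcal H$ such that $\{\pi(c)\xi : c\in\mathcal A\}$ is dense in $\mathcal H$. The inner product $\langle\cdot\,|\,\cdot\rangle$ is linear in the first variable. Let $a\in\mathcal A$ and let $\mathcal B$ be an $\mathbb F$-linear subspace of $\mathcal A$ that is not dense in $\mathcal A$. Suppose that there is a best approximation to $a$ in $\mathcal B$, that is, some $b_0\in\mathcal B$ with $\|a-b_0\|\le\|a-b\|$ for all $b\in\mathcal B$. Then $$\operatorname{dist}(a,\mathcal B)=\max\bigl\{\,|\langle\pi(a)\xi\,|\,\eta\rangle| \;:\; (\mathcal H,\pi,\xi)\text{ is a cyclic representation of }\mathcal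 A,\ \eta\in\mathcal H,\ \|\eta\|=1,\ \langle\pi(b)\xi\,|\,\eta\rangle=0\text{ for all }b\in\mathcal B\bigr\},$$ where $\operatorname{dist}(a,\mathcal B)=\inf\{\|a-b\| : b\in\mathcal B\}$; in particular the set on the right is non-empty and the maximum is attained. -/

import Mathlib

universe u v

/-- Positivity axiom for a unital Banach `*`-algebra satisfying the C*-identity: every
`1 + x⋆ x` is invertible. A *real* C*-algebra is a real Banach `*`-algebra with the C*-identity and
this property (the C*-identity alone is too weak over `ℝ`: it holds for `ℂ` with the trivial
involution). Over `ℂ` the property is automatic, see the instance below. -/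
class PositiveStarSquares (A : Type u) [Ring A] [StarRing A] : Prop where
  isUnit_one_add_star_mul_self : ∀ x : A, IsUnit (1 + star x * x)

/-- Every complex unital C*-algebra has the property, so in the complex case it adds nothing. -/
instance CStarAlgebra.positiveStarSquares (A : Type u) [CStarAlgebra A] :
    PositiveStarSquares A where
  isUnit_one_add_star_mul_self x := by
    let _ := CStarAlgebra.spectralOrder A
    have := CStarAlgebra.spectralOrderedRing A
    by_contra h
    have h1 : (-1 : ℝ) ∈ spectrum ℝ (star x * x) := by
      rw [spectrum.mem_iff]
      intro h2
      apply h
      have h3 : (1 + star x * x) = -(algebraMap ℝ A (-1) - star x * x) := by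
        simp [add_comm]
      rw [h3]
      exact h2.neg
    have h4 := spectrum_nonneg_of_nonneg (star_mul_self_nonneg x) h1
    norm_num at h4

/-- `b₀` is a best approximation to `a` in the subspace `B`. -/
def IsBestApproximation {𝕜 : Type v} {A : Type u} [RCLike 𝕜] [NormedRing A] [NormedAlgebra 𝕜 A]
    (a : A) (B : Submodule 𝕜 A) (b₀ : A) : Prop :=
  b₀ ∈ B ∧ ∀ b ∈ B, ‖a - b₀‖ ≤ ‖a - b‖

/-- A cyclic representation `(H, π, ξ)` of a unital C*-algebra `A` over `𝕜`: a Hilbert space `H`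
over `𝕜`, a unital `*`-homomorphism `π` into the bounded operators on `H`, and a unit vector `ξ`
whose orbit `{π c ξ : c ∈ A}` is dense in `H`. Such an `H` has at most the size of a completion of
a quotient of `A`, so up to unitary equivalence all of them live in the universe of `A`. -/
structure CyclicRepresentation (𝕜 : Type v) (A : Type u) [RCLike 𝕜] [NormedRing A] [StarRing A]
    [NormedAlgebra 𝕜 A] where
  H : Type u
  [normedAddCommGroup : NormedAddCommGroup H]
  [innerProductSpace : InnerProductSpace 𝕜 H]
  [completeSpace : CompleteSpace H]
  π : A →⋆ₐ[𝕜] (H →L[𝕜] H)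
  ξ : H
  norm_ξ : ‖ξ‖ = 1
  cyclic : DenseRange fun c : A => π c ξ

attribute [instance] CyclicRepresentation.normedAddCommGroup
  CyclicRepresentation.innerProductSpace CyclicRepresentation.completeSpace

/-!
By Hahn–Banach there is a functional `f` of norm one which vanishes on `B` and takes the value
`dist(a, B)` at `a`. For elements `cᵢ` of `A` one has `∑ |f cᵢ|² ≤ ‖∑ cᵢ⋆ cᵢ‖`, so a separation
argument produces a positive functional `σ` of norm at most one with `|f c|² ≤ σ (c⋆ c)` for all
`c`. In the Gelfand–Naimark–Segal representation `(H, π, ξ)` of `σ` this says `|f c| ≤ ‖π(c)ξ‖`,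
hence `f c = ⟨π(c)ξ | η⟩` with `‖η‖ ≤ 1`. As `1 = ‖f‖ ≤ ‖ξ‖ ‖η‖` and `‖ξ‖ ≤ 1`, both vectors are
unit vectors, so the distance belongs to the set. It bounds the set from above because
representations are contractive: `⟨π(a)ξ | η⟩ = ⟨π(a - b)ξ | η⟩` for all `b ∈ B`.

Over `ℝ` the spectral radius formula for a selfadjoint `x` is obtained by letting `A` act
isometrically on a complex Banach space. The invertibility of `1 + x⋆ x` excludes nonreal spectrum,
so `‖x‖` or `-‖x‖` lies in the real spectrum of `x`. This is what gives positivity of `c⋆ c`,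
monotonicity of the norm on positive elements, and contractivity of `*`-homomorphisms.
-/

section RealSpectrum

theorem norm_comp_flip_mul_le {A F : Type*} [NormedRing A] [NormedAlgebra ℝ A]
    [SeminormedAddCommGroup F] [NormedSpace ℝ F] (a : A) (φ : A →L[ℝ] F) :
    ‖φ.comp ((ContinuousLinearMap.mul ℝ A).flip a)‖ ≤ ‖a‖ * ‖φ‖ := by
  refine φ.comp _ |>.opNorm_le_bound (by positivity) fun b => ?_
  calc ‖φ (b * a)‖ ≤ ‖φ‖ * (‖b‖ * ‖a‖) := φ.le_opNorm_of_le (norm_mul_le b a)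
    _ = ‖a‖ * ‖φ‖ * ‖b‖ := by ring

/-- The regular representation of a real normed algebra on the complex Banach space of its
real-linear functionals with values in `ℂ`, given by `(a • φ) b = φ (b * a)`. Since it is isometric,
it gives access to complex spectral theory without norming the complexification. -/
noncomputable def complexRegularRepresentation (A : Type*) [NormedRing A] [NormedAlgebra ℝ A] :
    A →ₐ[ℝ] ((A →L[ℝ] ℂ) →L[ℂ] (A →L[ℝ] ℂ)) where
  toFun a := LinearMap.mkContinuous
    { toFun := fun φ => φ.comp ((ContinuousLinearMap.mul ℝ A).flip a)
      map_add' := fun _ _ => rfl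
      map_smul' := fun _ _ => rfl }
    ‖a‖ (norm_comp_flip_mul_le a)
  map_one' := by
    ext φ b
    exact congrArg φ (mul_one b)
  map_mul' a b := by
    ext φ c
    exact congrArg φ (mul_assoc c a b).symm
  map_zero' := by
    ext φ b
    exact (congrArg φ (mul_zero b)).trans (map_zero φ)
  map_add' a b := by
    ext φ c
    exact (congrArg φ (mul_add c a b)).trans (map_add φ _ _)
  commutes' r := by
    ext φ b
    exact (congrArg φ (by simp [Algebra.algebraMap_eq_smul_one])).trans (map_smul φ r b)

section Isometry

variable {A : Type*} [NormedRing A] [NormedAlgebra ℝ A]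

theorem complexRegularRepresentation_apply (a b : A) (φ : A →L[ℝ] ℂ) :
    complexRegularRepresentation A a φ b = φ (b * a) := rfl

variable [NormOneClass A]

theorem norm_complexRegularRepresentation (a : A) : ‖complexRegularRepresentation A a‖ = ‖a‖ := by
  refine le_antisymm
    (ContinuousLinearMap.opNorm_le_bound _ (norm_nonneg a) (norm_comp_flip_mul_le a)) ?_
  obtain ⟨g, hg, hga⟩ := exists_dual_vector'' ℝ a
  set φ : A →L[ℝ] ℂ := Complex.ofRealCLM.comp g
  have hφ : ‖φ‖ ≤ 1 := φ.opNorm_le_bound zero_le_one fun x => by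
    simpa [φ] using g.le_of_opNorm_le hg x
  calc ‖a‖ = ‖complexRegularRepresentation A a φ 1‖ := by
        simp [complexRegularRepresentation_apply, φ, hga]
    _ ≤ ‖complexRegularRepresentation A a φ‖ * ‖(1 : A)‖ := ContinuousLinearMap.le_opNorm _ _
    _ ≤ ‖complexRegularRepresentation A a‖ * ‖φ‖ * ‖(1 : A)‖ := by
        gcongr
        exact ContinuousLinearMap.le_opNorm _ _
    _ ≤ ‖complexRegularRepresentation A a‖ := by
        rw [norm_one, mul_one]
        exact mul_le_of_le_one_right (norm_nonneg (complexRegularRepresentation A a)) hφ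

end Isometry

theorem spectralRadius_eq_nnnorm_of_nnnorm_pow_two_pow {C : Type*} [NormedRing C]
    [NormedAlgebra ℂ C] [CompleteSpace C] {x : C} (hx : ∀ n : ℕ, ‖x ^ 2 ^ n‖₊ = ‖x‖₊ ^ 2 ^ n) :
    spectralRadius ℂ x = ‖x‖₊ := by
  have hlim := (spectrum.pow_nnnorm_pow_one_div_tendsto_nhds_spectralRadius x).comp
    (tendsto_pow_atTop_atTop_of_one_lt one_lt_two)
  refine tendsto_nhds_unique hlim (tendsto_const_nhds.congr fun n => ?_)
  rw [Function.comp_apply, hx, ENNReal.coe_pow, one_div]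
  exact (ENNReal.pow_rpow_inv_natCast (by positivity) _).symm

theorem not_isUnit_sq_add_sq_of_mem_spectrum {C : Type*} [Ring C] [Algebra ℂ C] [Algebra ℝ C]
    [IsScalarTower ℝ ℂ C] {y : C} {z : ℂ} (hz : z ∈ spectrum ℂ y) :
    ¬ IsUnit ((y - algebraMap ℝ C z.re) ^ 2 + algebraMap ℝ C (z.im ^ 2)) := by
  let q : Polynomial ℂ :=
    (Polynomial.X - Polynomial.C (z.re : ℂ)) ^ 2 + Polynomial.C ((z.im : ℂ) ^ 2)
  have hroot : q.eval z = 0 := by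
    have hzre : z - z.re = z.im * Complex.I := by
      nth_rewrite 1 [← Complex.re_add_im z]
      ring
    simp [q, hzre, mul_pow]
  have hq : Polynomial.aeval y q =
      (y - algebraMap ℝ C z.re) ^ 2 + algebraMap ℝ C (z.im ^ 2) := by
    simp only [q, map_add, map_sub, map_pow, Polynomial.aeval_X, Polynomial.aeval_C,
      IsScalarTower.algebraMap_apply ℝ ℂ C, Complex.coe_algebraMap]
  have hmem := spectrum.subset_polynomial_aeval y q ⟨z, hz, hroot⟩
  rwa [hq, spectrum.zero_mem_iff] at hmem

theorem exists_norm_eq_not_isUnit_sq_add_sq {A : Type*} [NormedRing A] [NormedAlgebra ℝ A]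
    [NormOneClass A] {x : A} (hx : ∀ n : ℕ, ‖x ^ 2 ^ n‖₊ = ‖x‖₊ ^ 2 ^ n) :
    ∃ z : ℂ, ‖z‖ = ‖x‖ ∧
      ¬ IsUnit ((x - algebraMap ℝ A z.re) ^ 2 + algebraMap ℝ A (z.im ^ 2)) := by
  set j := complexRegularRepresentation A
  have hj : ∀ a, ‖j a‖₊ = ‖a‖₊ := fun a => NNReal.eq (norm_complexRegularRepresentation a)
  have : Nontrivial ((A →L[ℝ] ℂ) →L[ℂ] (A →L[ℝ] ℂ)) :=
    nontrivial_of_ne (j 1) 0 fun h => by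
      have hone : ‖j 1‖ = ‖(1 : A)‖ := norm_complexRegularRepresentation 1
      rw [h, ContinuousLinearMap.opNorm_zero, norm_one] at hone
      exact zero_ne_one hone
  obtain ⟨z, hz, hzr⟩ := spectrum.exists_nnnorm_eq_spectralRadius (j x)
  rw [spectralRadius_eq_nnnorm_of_nnnorm_pow_two_pow
    (fun n => by rw [← map_pow, hj, hj, hx]), hj] at hzr
  refine ⟨z, congrArg NNReal.toReal (ENNReal.coe_injective hzr), fun hunit =>
    not_isUnit_sq_add_sq_of_mem_spectrum hz ?_⟩
  simpa only [map_add, map_sub, map_pow, AlgHom.commutes] using hunit.map j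

theorem exists_mem_spectrum_abs_eq_norm {A : Type*} [NormedRing A] [NormedAlgebra ℝ A]
    [StarRing A] [CStarRing A] [NormOneClass A] {x : A} (hx : IsSelfAdjoint x)
    (hunit : ∀ α β : ℝ, β ≠ 0 → IsUnit ((x - algebraMap ℝ A α) ^ 2 + algebraMap ℝ A (β ^ 2))) :
    ∃ r ∈ spectrum ℝ x, |r| = ‖x‖ := by
  obtain ⟨z, hzx, hz⟩ := exists_norm_eq_not_isUnit_sq_add_sq hx.nnnorm_pow_two_pow
  have him : z.im = 0 := by
    by_contra him
    exact hz (hunit z.re z.im him)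
  refine ⟨z.re, fun hre => hz ?_, by rw [← hzx, Complex.abs_re_eq_norm.2 him]⟩
  rw [him, zero_pow two_ne_zero, map_zero, add_zero, ← neg_sub, neg_sq]
  exact hre.pow 2

end RealSpectrum

section RealCStarAlgebra

theorem starModule_real_of_rclike (𝕜 A : Type*) [RCLike 𝕜] [AddCommMonoid A] [StarAddMonoid A]
    [Module 𝕜 A] [StarModule 𝕜 A] [Module ℝ A] [IsScalarTower ℝ 𝕜 A] : StarModule ℝ A where
  star_smul r a := by
    rw [← algebraMap_smul 𝕜 r a, star_smul, ← algebraMap_star_comm, algebraMap_smul]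

theorem isUnit_star_mul_self_add_algebraMap {A : Type*} [Ring A] [StarRing A] [Algebra ℝ A]
    [StarModule ℝ A] [PositiveStarSquares A] (c : A) {r : ℝ} (hr : 0 < r) :
    IsUnit (star c * c + algebraMap ℝ A r) := by
  have hfactor : star c * c + algebraMap ℝ A r =
      algebraMap ℝ A r * (1 + star ((√r)⁻¹ • c) * ((√r)⁻¹ • c)) := by
    rw [star_smul, star_trivial (√r)⁻¹, smul_mul_smul_comm, ← mul_inv, Real.mul_self_sqrt hr.le,
      mul_add, mul_one, ← Algebra.smul_def, smul_smul, mul_inv_cancel₀ hr.ne', one_smul, add_comm]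
  rw [hfactor]
  exact (hr.ne'.isUnit.map (algebraMap ℝ A)).mul
    (PositiveStarSquares.isUnit_one_add_star_mul_self _)

theorem isUnit_sub_algebraMap_sq_add {A : Type*} [Ring A] [StarRing A] [Algebra ℝ A]
    [StarModule ℝ A] [PositiveStarSquares A] {x : A} (hx : IsSelfAdjoint x) (α : ℝ) {β : ℝ}
    (hβ : β ≠ 0) : IsUnit ((x - algebraMap ℝ A α) ^ 2 + algebraMap ℝ A (β ^ 2)) := by
  have hsa : IsSelfAdjoint (x - algebraMap ℝ A α) := hx.sub (.algebraMap A (.all α))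
  have h := isUnit_star_mul_self_add_algebraMap (x - algebraMap ℝ A α) (sq_pos_of_ne_zero hβ)
  rwa [hsa.star_eq, ← sq] at h

theorem abs_sub_le_of_mem_spectrum {A : Type*} [NormedRing A] [NormedAlgebra ℝ A]
    [CompleteSpace A] [NormOneClass A] {x : A} {r t s : ℝ} (hr : r ∈ spectrum ℝ x)
    (hxt : ‖algebraMap ℝ A t - x‖ ≤ s) : |t - r| ≤ s := by
  have hmem : t - r ∈ spectrum ℝ (algebraMap ℝ A t - x) := by
    rw [← spectrum.singleton_sub_eq]
    exact Set.sub_mem_sub rfl hr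
  exact (spectrum.norm_le_norm_of_mem hmem).trans hxt

theorem nonneg_of_mem_spectrum_star_mul_self {A : Type*} [Ring A] [StarRing A] [Algebra ℝ A]
    [StarModule ℝ A] [PositiveStarSquares A] {c : A} {r : ℝ} (hr : r ∈ spectrum ℝ (star c * c)) :
    0 ≤ r := by
  by_contra! hneg
  refine hr ?_
  have h := (isUnit_star_mul_self_add_algebraMap c (neg_pos.2 hneg)).neg
  rwa [map_neg, neg_add_rev, neg_neg, ← sub_eq_add_neg] at h

/-- The cone of positive elements of a real C*-algebra, described without spectral theory: the
selfadjoint elements lying in a ball which is centred at a scalar and has `0` on its boundary. -/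
def normPositiveCone (A : Type*) [NormedRing A] [StarRing A] [NormedAlgebra ℝ A]
    [StarModule ℝ A] : PointedCone ℝ A where
  carrier := {h | IsSelfAdjoint h ∧ ∃ t : ℝ, ‖algebraMap ℝ A t - h‖ ≤ t}
  zero_mem' := ⟨.zero A, 0, by simp⟩
  add_mem' := by
    rintro h k ⟨hh, s, hs⟩ ⟨hk, t, ht⟩
    refine ⟨hh.add hk, s + t, ?_⟩
    rw [map_add, add_sub_add_comm]
    exact norm_add_le_of_le hs ht
  smul_mem' := by
    rintro ⟨c, hc⟩ h ⟨hh, t, ht⟩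
    refine ⟨(IsSelfAdjoint.all c).smul hh, c * t, ?_⟩
    change ‖algebraMap ℝ A (c * t) - c • h‖ ≤ c * t
    rw [map_mul, ← Algebra.smul_def, ← smul_sub, norm_smul, Real.norm_of_nonneg hc]
    gcongr

section CStarRing

variable {A : Type*} [NormedRing A] [StarRing A] [CStarRing A] [NormedAlgebra ℝ A]
  [StarModule ℝ A] [PositiveStarSquares A] [NormOneClass A]

theorem exists_mem_spectrum_abs_eq_norm_of_positiveStarSquares {x : A} (hx : IsSelfAdjoint x) :
    ∃ r ∈ spectrum ℝ x, |r| = ‖x‖ :=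
  exists_mem_spectrum_abs_eq_norm hx fun α _ hβ => isUnit_sub_algebraMap_sq_add hx α hβ

variable [CompleteSpace A]

theorem star_mul_self_mem_normPositiveCone (c : A) : star c * c ∈ normPositiveCone A := by
  set t := ‖star c * c‖
  refine ⟨.star_mul_self c, t, ?_⟩
  obtain ⟨r, hr, hrt⟩ := exists_mem_spectrum_abs_eq_norm_of_positiveStarSquares
    ((IsSelfAdjoint.algebraMap A (.all t)).sub (.star_mul_self c))
  rw [← spectrum.singleton_sub_eq, Set.singleton_sub] at hr
  obtain ⟨l, hl, rfl⟩ := hr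
  have hl0 : 0 ≤ l := nonneg_of_mem_spectrum_star_mul_self hl
  have hlt : l ≤ t := (le_abs_self l).trans (spectrum.norm_le_norm_of_mem hl)
  rw [← hrt, abs_of_nonneg (sub_nonneg.2 hlt)]
  exact sub_le_self t hl0

theorem norm_le_norm_add_of_mem_normPositiveCone {x y : A} (hx : x ∈ normPositiveCone A)
    (hy : y ∈ normPositiveCone A) : ‖x‖ ≤ ‖x + y‖ := by
  obtain ⟨hxsa, s, hs⟩ := hx
  obtain ⟨-, t, ht⟩ := hy
  obtain ⟨r, hr, hrx⟩ := exists_mem_spectrum_abs_eq_norm_of_positiveStarSquares hxsa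
  have hr0 : 0 ≤ r := by linarith [(abs_le.1 (abs_sub_le_of_mem_spectrum hr hs)).2]
  have hball : ‖algebraMap ℝ A (-t) - x‖ ≤ t + ‖x + y‖ := by
    have hdecomp : algebraMap ℝ A (-t) - x = -((algebraMap ℝ A t - y) + (x + y)) := by
      rw [map_neg]
      abel
    rw [hdecomp, norm_neg]
    exact norm_add_le_of_le ht le_rfl
  have hdist := (abs_le.1 (abs_sub_le_of_mem_spectrum hr hball)).1
  rw [← hrx, abs_of_nonneg hr0]
  linarith

end CStarRing

theorem norm_realStarAlgHom_apply_le {A C : Type*} [NormedRing A] [StarRing A] [CStarRing A]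
    [CompleteSpace A] [NormedAlgebra ℝ A] [StarModule ℝ A] [PositiveStarSquares A]
    [NormedRing C] [StarRing C] [CStarRing C] [NormedAlgebra ℝ C] (π : A →⋆ₐ[ℝ] C) (x : A) :
    ‖π x‖ ≤ ‖x‖ := by
  nontriviality C
  have : Nontrivial A := RingHom.domain_nontrivial (π : A →+* C)
  have hsa : IsSelfAdjoint (star x * x) := .star_mul_self x
  obtain ⟨r, hr, hrx⟩ := exists_mem_spectrum_abs_eq_norm (hsa.map π) fun α β hβ => by
    simpa only [map_add, map_sub, map_pow, AlgHomClass.commutes] using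
      (isUnit_sub_algebraMap_sq_add hsa α hβ).map π
  have hle : |r| ≤ ‖star x * x‖ :=
    spectrum.norm_le_norm_of_mem (AlgHom.spectrum_apply_subset π _ hr)
  rw [hrx, map_mul, map_star, CStarRing.norm_star_mul_self, CStarRing.norm_star_mul_self] at hle
  exact (mul_self_le_mul_self_iff (norm_nonneg (π x)) (norm_nonneg x)).2 hle

theorem norm_starAlgHom_apply_le {𝕜 A C : Type*} [RCLike 𝕜] [NormedRing A] [StarRing A]
    [CStarRing A] [CompleteSpace A] [NormedAlgebra 𝕜 A] [StarModule 𝕜 A] [PositiveStarSquares A]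
    [NormedRing C] [StarRing C] [CStarRing C] [NormedAlgebra 𝕜 C] (π : A →⋆ₐ[𝕜] C) (x : A) :
    ‖π x‖ ≤ ‖x‖ := by
  let _ : NormedAlgebra ℝ A := .restrictScalars ℝ 𝕜 A
  let _ : NormedAlgebra ℝ C := .restrictScalars ℝ 𝕜 C
  have : IsScalarTower ℝ 𝕜 A := RestrictScalars.isScalarTower ℝ 𝕜 A
  have : IsScalarTower ℝ 𝕜 C := RestrictScalars.isScalarTower ℝ 𝕜 C
  have : StarModule ℝ A := starModule_real_of_rclike 𝕜 A
  exact norm_realStarAlgHom_apply_le (π.restrictScalars ℝ) x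

end RealCStarAlgebra

section DominatingFunctional

open scoped NNReal ComplexConjugate

/-- The functional separates the open cone `{(h, t) | ‖h‖ < t}` from the convex cone generated by
the pairs `(x i, r i)`. -/
theorem exists_strongDual_norm_le_one_forall_le {E ι : Type*} [SeminormedAddCommGroup E]
    [NormedSpace ℝ E] (x : ι → E) (r : ι → ℝ)
    (hxr : ∀ (s : Finset ι) (t : ι → ℝ≥0), ∑ i ∈ s, t i * r i ≤ ‖∑ i ∈ s, t i • x i‖) :
    ∃ φ : StrongDual ℝ E, ‖φ‖ ≤ 1 ∧ ∀ i, r i ≤ φ (x i) := by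
  set K : PointedCone ℝ (E × ℝ) := PointedCone.hull ℝ (Set.range fun i => (x i, r i))
  have hdisj : Disjoint {p : E × ℝ | ‖p.1‖ < p.2} (K : Set (E × ℝ)) := by
    rw [Set.disjoint_left]
    rintro p hp hpK
    obtain ⟨t, rfl⟩ := Finsupp.mem_span_range_iff_exists_finsupp.1 hpK
    rw [Set.mem_ofPred_eq, Finsupp.sum, Prod.fst_sum, Prod.snd_sum] at hp
    exact (hxr t.support t).not_gt hp
  have hconv : Convex ℝ {p : E × ℝ | ‖p.1‖ < p.2} := by
    simpa using (convexOn_norm convex_univ).convex_strict_epigraph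
  obtain ⟨g, u, hgu, hug⟩ := geometric_hahn_banach_open hconv
    (isOpen_lt (by fun_prop) (by fun_prop)) K.convex hdisj
  have hg : ∀ h t, g (h, t) = g (h, 0) + t * g (0, 1) := fun h t => by
    rw [← smul_eq_mul, ← map_smul, ← map_add]
    simp
  have hu : u ≤ 0 := by simpa using hug 0 K.zero_mem
  set l := -g (0, 1)
  have hl : 0 < l := neg_pos.2 ((hgu (0, 1) (by simp)).trans_le hu)
  have hnonneg : ∀ p ∈ K, 0 ≤ g p := fun p hp => by
    by_contra! hneg
    have hmem := hug _ (K.smul_mem (div_nonneg_of_nonpos (sub_nonpos.2 (hu.trans zero_le_one))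
      hneg.le) hp)
    rw [map_smul, smul_eq_mul, div_mul_cancel₀ _ hneg.ne] at hmem
    linarith
  set φ : StrongDual ℝ E := l⁻¹ • g.comp (.inl ℝ E ℝ)
  have hφ : ∀ h, φ h = l⁻¹ * g (h, 0) := fun h => rfl
  have hle : ∀ h, φ h ≤ ‖h‖ := fun h => le_of_forall_gt_imp_ge_of_dense fun t ht => by
    rw [hφ, inv_mul_le_iff₀ hl]
    linarith [hg h t, hgu (h, t) ht]
  refine ⟨φ, φ.opNorm_le_bound zero_le_one fun h => ?_, fun i => ?_⟩
  · rw [one_mul]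
    exact abs_le'.2 ⟨hle h, by simpa only [map_neg, norm_neg] using hle (-h)⟩
  · rw [hφ, le_inv_mul_iff₀ hl]
    linarith [hg (x i) (r i), hnonneg _ (PointedCone.subset_hull ⟨i, rfl⟩)]

theorem sum_star_sub_smul_mul_self {R A ι : Type*} [CommRing R] [StarRing R] [Ring A] [StarRing A]
    [Algebra R A] [StarModule R A] {s : Finset ι} {c : ι → A} {z : ι → R} {w : A} {r : R}
    (hz : ∑ i ∈ s, star (z i) * z i = r) (hw : ∑ i ∈ s, star (z i) • c i = r • w) :
    ∑ i ∈ s, star (c i - z i • w) * (c i - z i • w) =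
      ∑ i ∈ s, star (c i) * c i - r • (star w * w) := by
  have hr : star r = r := by
    rw [← hz, star_sum]
    simp [mul_comm]
  have hleft : ∑ i ∈ s, star (c i) * (z i • w) = r • (star w * w) := by
    calc ∑ i ∈ s, star (c i) * (z i • w) = star (∑ i ∈ s, star (z i) • c i) * w := by
          simp [star_sum, Finset.sum_mul]
      _ = r • (star w * w) := by rw [hw, star_smul, hr, smul_mul_assoc]
  have hright : ∑ i ∈ s, star (z i • w) * (c i - z i • w) = 0 := by
    calc ∑ i ∈ s, star (z i • w) * (c i - z i • w)
        = star w * (∑ i ∈ s, star (z i) • c i - (∑ i ∈ s, star (z i) * z i) • w) := by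
          simp [Finset.sum_smul, Finset.mul_sum, mul_sub, mul_smul, smul_comm (z _)]
      _ = 0 := by rw [hw, hz, sub_self, mul_zero]
  calc ∑ i ∈ s, star (c i - z i • w) * (c i - z i • w)
      = ∑ i ∈ s, star (c i) * c i - ∑ i ∈ s, star (c i) * (z i • w) -
          ∑ i ∈ s, star (z i • w) * (c i - z i • w) := by
        simp only [star_sub, sub_mul, mul_sub, Finset.sum_sub_distrib]
        abel
    _ = ∑ i ∈ s, star (c i) * c i - r • (star w * w) := by rw [hright, hleft, sub_zero]

variable {𝕜 A : Type*} [RCLike 𝕜] [NormedRing A] [StarRing A] [CStarRing A] [CompleteSpace A]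
  [NormedAlgebra 𝕜 A] [StarModule 𝕜 A] [NormedAlgebra ℝ A] [IsScalarTower ℝ 𝕜 A]
  [PositiveStarSquares A] [NormOneClass A] {f : StrongDual 𝕜 A}

/-- Writing `r = ∑ |f (c i)|²` and `w = r⁻¹ ∑ conj (f (c i)) c i`, one has `f w = 1`, hence
`1 ≤ ‖w‖`, and completing the square gives `r w⋆ w ≤ ∑ (c i)⋆ (c i)`. -/
theorem sum_norm_sq_le_norm_sum_star_mul_self (hf : ‖f‖ ≤ 1) {ι : Type*} (s : Finset ι)
    (c : ι → A) : ∑ i ∈ s, ‖f (c i)‖ ^ 2 ≤ ‖∑ i ∈ s, star (c i) * c i‖ := by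
  have : StarModule ℝ A := starModule_real_of_rclike 𝕜 A
  set r := ∑ i ∈ s, ‖f (c i)‖ ^ 2 with hr_def
  have hr0 : 0 ≤ r := Finset.sum_nonneg fun i _ => sq_nonneg ‖f (c i)‖
  rcases hr0.eq_or_lt with hr | hr
  · rw [← hr]
    exact norm_nonneg _
  have hr𝕜 : (r : 𝕜) ≠ 0 := RCLike.ofReal_ne_zero.2 hr.ne'
  have hsum : ∑ i ∈ s, star (f (c i)) * f (c i) = (r : 𝕜) := by
    simp [hr_def, RCLike.conj_mul]
  obtain ⟨w, hw⟩ : ∃ w : A, ∑ i ∈ s, star (f (c i)) • c i = (r : 𝕜) • w :=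
    ⟨_, (smul_inv_smul₀ hr𝕜 _).symm⟩
  have hfw : f w = 1 := mul_left_cancel₀ hr𝕜 <| by
    simpa only [map_sum, map_smul, smul_eq_mul, hsum, mul_one] using congrArg f hw.symm
  have hw1 : 1 ≤ ‖w‖ := by
    simpa [hfw] using f.le_of_opNorm_le hf w
  have hdecomp := sum_star_sub_smul_mul_self hsum hw
  rw [← RCLike.real_smul_eq_coe_smul, eq_sub_iff_add_eq'] at hdecomp
  calc r ≤ r * (‖w‖ * ‖w‖) := le_mul_of_one_le_right hr.le (one_le_mul_of_one_le_of_one_le hw1 hw1)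
    _ = ‖r • (star w * w)‖ := by
      rw [norm_smul, Real.norm_of_nonneg hr.le, CStarRing.norm_star_mul_self]
    _ ≤ ‖∑ i ∈ s, star (c i) * c i‖ := by
      rw [← hdecomp]
      exact norm_le_norm_add_of_mem_normPositiveCone
        ((normPositiveCone A).smul_mem hr.le (star_mul_self_mem_normPositiveCone w))
        (Submodule.sum_mem _ fun i _ => star_mul_self_mem_normPositiveCone _)

theorem exists_real_functional_dominating (hf : ‖f‖ ≤ 1) :
    ∃ φ : StrongDual ℝ A, ‖φ‖ ≤ 1 ∧ ∀ c, ‖f c‖ ^ 2 ≤ φ (star c * c) := by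
  have : StarModule ℝ A := starModule_real_of_rclike 𝕜 A
  refine exists_strongDual_norm_le_one_forall_le (fun c => star c * c) (fun c => ‖f c‖ ^ 2)
    fun s t => ?_
  have hsqrt : ∀ c : A, star (√(t c) • c) * (√(t c) • c) = t c • (star c * c) := fun c => by
    rw [star_smul, star_trivial, smul_mul_smul_comm, Real.mul_self_sqrt (t c).coe_nonneg,
      NNReal.smul_def]
  have hfsqrt : ∀ c : A, ‖f (√(t c) • c)‖ ^ 2 = t c * ‖f c‖ ^ 2 := fun c => by
    rw [← algebraMap_smul 𝕜 √(t c), map_smul, algebraMap_smul, norm_smul, mul_pow,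
      Real.norm_of_nonneg (Real.sqrt_nonneg _),
      Real.sq_sqrt (t c).coe_nonneg]
  simpa only [hsqrt, hfsqrt] using
    sum_norm_sq_le_norm_sum_star_mul_self hf s fun c => √(t c) • c

theorem exists_hermitian_real_functional_dominating (hf : ‖f‖ ≤ 1) :
    ∃ φ : StrongDual ℝ A, ‖φ‖ ≤ 1 ∧ (∀ x, φ (star x) = φ x) ∧
      ∀ c, ‖f c‖ ^ 2 ≤ φ (star c * c) := by
  have : StarModule ℝ A := starModule_real_of_rclike 𝕜 A
  obtain ⟨φ, hφ, hfφ⟩ := exists_real_functional_dominating hf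
  set ψ : StrongDual ℝ A := (2⁻¹ : ℝ) • (φ + φ.comp (starL' ℝ : A ≃L[ℝ] A).toContinuousLinearMap)
  have hψ : ∀ x, ψ x = 2⁻¹ * (φ x + φ (star x)) := fun x => rfl
  refine ⟨ψ, ψ.opNorm_le_bound zero_le_one fun x => ?_, fun x => ?_, fun c => ?_⟩
  · have hx := φ.le_of_opNorm_le hφ x
    have hstar := φ.le_of_opNorm_le hφ (star x)
    rw [norm_star] at hstar
    rw [hψ, norm_mul, Real.norm_of_nonneg (by positivity)]
    linarith [norm_add_le (φ x) (φ (star x))]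
  · rw [hψ, hψ, star_star, add_comm]
  · rw [hψ, star_mul, star_star]
    linarith [hfφ c]

omit [NormedAlgebra ℝ A] [IsScalarTower ℝ 𝕜 A] in
theorem exists_hermitian_functional_dominating (hf : ‖f‖ ≤ 1) :
    ∃ σ : StrongDual 𝕜 A, ‖σ‖ ≤ 1 ∧ (∀ x, σ (star x) = conj (σ x)) ∧
      ∀ c, ‖f c‖ ^ 2 ≤ RCLike.re (σ (star c * c)) := by
  let _ : NormedAlgebra ℝ A := NormedAlgebra.restrictScalars ℝ 𝕜 A
  have : IsScalarTower ℝ 𝕜 A := RestrictScalars.isScalarTower ℝ 𝕜 A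
  obtain ⟨φ, hφ, hstar, hfφ⟩ := exists_hermitian_real_functional_dominating hf
  refine ⟨φ.extendRCLike, (StrongDual.norm_extendRCLike φ).trans_le hφ,
    fun x => RCLike.ext ?_ ?_, fun c => ?_⟩
  · rw [RCLike.conj_re, StrongDual.re_extendRCLike_apply, StrongDual.re_extendRCLike_apply, hstar]
  · rw [RCLike.conj_im, StrongDual.im_extendRCLike_apply, StrongDual.im_extendRCLike_apply,
      ← hstar (_ • star x), star_smul, star_star, ← starRingEnd_apply, RCLike.conj_I, neg_smul,
      map_neg]
  · rw [StrongDual.re_extendRCLike_apply]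
    exact hfφ c

end DominatingFunctional

section GelfandNaimarkSegal

open scoped ComplexConjugate

variable {𝕜 : Type v} [RCLike 𝕜]

theorem exists_hilbertSpace_inner_eq {V : Type u} [AddCommGroup V] [Module 𝕜 V]
    (core : PreInnerProductSpace.Core 𝕜 V) :
    ∃ (H : Type u) (_ : NormedAddCommGroup H) (_ : InnerProductSpace 𝕜 H) (_ : CompleteSpace H)
      (Λ : V →ₗ[𝕜] H), DenseRange Λ ∧ ∀ x y, inner 𝕜 (Λ x) (Λ y) = core.inner x y :=
  let _ : SeminormedAddCommGroup V :=
    InnerProductSpace.Core.toSeminormedAddCommGroup (c := core)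
  let _ : InnerProductSpace 𝕜 V := .ofCore core
  ⟨UniformSpace.Completion V, inferInstance, inferInstance, inferInstance,
    UniformSpace.Completion.toComplL.toLinearMap, UniformSpace.Completion.denseRange_coe,
    UniformSpace.Completion.inner_coe⟩

theorem le_mul_of_logConvex_of_le_geom {u : ℕ → ℝ} {C M : ℝ} (hu : ∀ n, 0 ≤ u n) (hM : 0 ≤ M)
    (hconvex : ∀ n, u (n + 1) ^ 2 ≤ u n * u (n + 2)) (hC : ∀ n, u n ≤ C * M ^ n) :
    u 1 ≤ M * u 0 := by
  by_contra! hlt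
  have hpos1 : 0 < u 1 := (mul_nonneg hM (hu 0)).trans_lt hlt
  have hpos0 : 0 < u 0 := pos_of_mul_pos_left ((pow_pos hpos1 2).trans_le (hconvex 0)) (hu 2)
  have hM0 : 0 < M := hM.lt_of_ne' fun h => by
    have h1 := hC 1
    rw [h] at h1
    linarith
  set q := u 1 / u 0
  have hq : 0 < q := div_pos hpos1 hpos0
  have hratio : ∀ n, 0 < u n ∧ q * u n ≤ u (n + 1) := by
    intro n
    induction n with
    | zero => exact ⟨hpos0, (div_mul_cancel₀ _ hpos0.ne').le⟩
    | succ n ih =>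
      have hpos : 0 < u (n + 1) := (mul_pos hq ih.1).trans_le ih.2
      refine ⟨hpos, le_of_mul_le_mul_left ?_ ih.1⟩
      calc u n * (q * u (n + 1)) = q * u n * u (n + 1) := by ring
        _ ≤ u (n + 1) * u (n + 1) := by gcongr; exact ih.2
        _ ≤ u n * u (n + 2) := (sq _).symm.trans_le (hconvex n)
  obtain ⟨n, hn⟩ := pow_unbounded_of_one_lt (C / u 0)
    ((one_lt_div hM0).2 ((lt_div_iff₀ hpos0).2 hlt))
  rw [div_pow, div_lt_div_iff₀ hpos0 (by positivity)] at hn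
  exact hn.not_ge ((geom_le hq.le n fun k _ => (hratio k).2).trans (hC n))

section LeftMultiplicationBound

variable {A H : Type*} [NormedRing A] [StarRing A] [NormOneClass A] [SeminormedAddCommGroup H]
  [InnerProductSpace 𝕜 H] {Λ : A → H} {C : ℝ}

theorem norm_map_mul_le_of_isSelfAdjoint
    (hadj : ∀ a b c, inner 𝕜 (Λ (a * b)) (Λ c) = inner 𝕜 (Λ b) (Λ (star a * c)))
    (hC : ∀ a, ‖Λ a‖ ≤ C * ‖a‖) {h : A} (hh : IsSelfAdjoint h) (b : A) :
    ‖Λ (h * b)‖ ≤ ‖h‖ * ‖Λ b‖ := by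
  have hsq : ∀ x, ‖Λ (h * x)‖ ^ 2 ≤ ‖Λ x‖ * ‖Λ (h * (h * x))‖ := fun x => by
    rw [← inner_self_eq_norm_sq (𝕜 := 𝕜), hadj, hh.star_eq]
    exact (RCLike.re_le_norm _).trans (norm_inner_le_norm _ _)
  have hC0 : 0 ≤ C := by simpa using (norm_nonneg _).trans (hC 1)
  simpa using le_mul_of_logConvex_of_le_geom (u := fun n => ‖Λ (h ^ n * b)‖) (C := C * ‖b‖)
    (fun n => norm_nonneg _) (norm_nonneg h)
    (fun n => by simpa only [pow_succ', mul_assoc] using hsq (h ^ n * b))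
    (fun n => calc
      ‖Λ (h ^ n * b)‖ ≤ C * ‖h ^ n * b‖ := hC _
      _ ≤ C * (‖h‖ ^ n * ‖b‖) := by
        gcongr
        exact norm_mul_le_of_le (norm_pow_le h n) le_rfl
      _ = C * ‖b‖ * ‖h‖ ^ n := by ring)

theorem norm_map_mul_le [NormedStarGroup A]
    (hadj : ∀ a b c, inner 𝕜 (Λ (a * b)) (Λ c) = inner 𝕜 (Λ b) (Λ (star a * c)))
    (hC : ∀ a, ‖Λ a‖ ≤ C * ‖a‖) (a b : A) : ‖Λ (a * b)‖ ≤ ‖a‖ * ‖Λ b‖ := by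
  refine le_of_sq_le_sq ?_ (by positivity)
  calc ‖Λ (a * b)‖ ^ 2 = RCLike.re (inner 𝕜 (Λ b) (Λ (star a * a * b))) := by
        rw [← inner_self_eq_norm_sq (𝕜 := 𝕜), hadj, mul_assoc]
    _ ≤ ‖Λ b‖ * ‖Λ (star a * a * b)‖ := (RCLike.re_le_norm _).trans (norm_inner_le_norm _ _)
    _ ≤ ‖Λ b‖ * (‖a‖ * ‖a‖ * ‖Λ b‖) := by
        gcongr
        refine (norm_map_mul_le_of_isSelfAdjoint hadj hC (.star_mul_self a) b).trans ?_
        gcongr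
        exact norm_mul_le_of_le (norm_star a).le le_rfl
    _ = (‖a‖ * ‖Λ b‖) ^ 2 := by ring

end LeftMultiplicationBound

section InducedRepresentation

variable {A H : Type*} [Ring A] [StarRing A] [Algebra 𝕜 A] [NormedAddCommGroup H]
  [InnerProductSpace 𝕜 H] [CompleteSpace H] {Λ : A →ₗ[𝕜] H}

/-- The representation of a `*`-algebra `A` by left multiplication on a Hilbert space in which `A`
has dense image under `Λ`. It exists when left multiplications are bounded and the adjoint of
left multiplication by `a` is left multiplication by `star a`. -/
noncomputable def inducedRepresentation (hΛ : DenseRange Λ)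
    (hbound : ∀ a, ∃ C, ∀ b, ‖Λ (a * b)‖ ≤ C * ‖Λ b‖)
    (hadj : ∀ a b c, inner 𝕜 (Λ (a * b)) (Λ c) = inner 𝕜 (Λ b) (Λ (star a * c))) :
    A →⋆ₐ[𝕜] (H →L[𝕜] H) :=
  have hmul (a b : A) : (Λ ∘ₗ LinearMap.mulLeft 𝕜 a).extendOfNorm Λ (Λ b) = Λ (a * b) :=
    LinearMap.extendOfNorm_eq hΛ (hbound a) b
  have hext {S T : H →L[𝕜] H} (h : ∀ b, S (Λ b) = T (Λ b)) : S = T :=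
    ContinuousLinearMap.ext_on (hΛ.mono Submodule.subset_span) (Set.forall_mem_range.2 h)
  { toFun := fun a => (Λ ∘ₗ LinearMap.mulLeft 𝕜 a).extendOfNorm Λ
    map_one' := hext fun b => by rw [hmul, one_mul, one_apply_eq_self]
    map_mul' := fun a a' => hext fun b => by
      rw [mul_apply_eq_comp, hmul, hmul, hmul, mul_assoc]
    map_zero' := hext fun b => by
      rw [hmul, zero_mul, map_zero, zero_apply]
    map_add' := fun a a' => hext fun b => by
      rw [add_apply, hmul, hmul, hmul, add_mul, map_add]
    commutes' := fun r => hext fun b => by simp [hmul, Algebra.algebraMap_eq_smul_one]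
    map_star' := fun a => by
      rw [ContinuousLinearMap.star_eq_adjoint, ContinuousLinearMap.eq_adjoint_iff]
      exact hΛ.induction_on₂ (isClosed_eq (by fun_prop) (by fun_prop)) fun b c => by
        rw [hmul, hmul, hadj, star_star] }

theorem inducedRepresentation_apply (hΛ : DenseRange Λ)
    (hbound : ∀ a, ∃ C, ∀ b, ‖Λ (a * b)‖ ≤ C * ‖Λ b‖)
    (hadj : ∀ a b c, inner 𝕜 (Λ (a * b)) (Λ c) = inner 𝕜 (Λ b) (Λ (star a * c))) (a b : A) :
    inducedRepresentation hΛ hbound hadj a (Λ b) = Λ (a * b) :=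
  LinearMap.extendOfNorm_eq hΛ (hbound a) b

end InducedRepresentation

theorem exists_inner_eq_of_norm_le {V H : Type*} [AddCommGroup V] [Module 𝕜 V]
    [NormedAddCommGroup H] [InnerProductSpace 𝕜 H] [CompleteSpace H] {Λ : V →ₗ[𝕜] H}
    (hΛ : DenseRange Λ) (f : V →ₗ[𝕜] 𝕜) (hf : ∀ c, ‖f c‖ ≤ ‖Λ c‖) :
    ∃ η : H, ‖η‖ ≤ 1 ∧ ∀ c, inner 𝕜 η (Λ c) = f c := by
  have hbound : ∀ c, ‖f c‖ ≤ 1 * ‖Λ c‖ := by simpa using hf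
  refine ⟨(InnerProductSpace.toDual 𝕜 H).symm (f.extendOfNorm Λ), ?_, fun c => ?_⟩
  · rw [LinearIsometryEquiv.norm_map]
    exact LinearMap.opNorm_extendOfNorm_le hΛ zero_le_one hbound
  · rw [InnerProductSpace.toDual_symm_apply]
    exact LinearMap.extendOfNorm_eq hΛ ⟨1, hbound⟩ c

section Representation

variable {A : Type u} [NormedRing A] [StarRing A] [NormedAlgebra 𝕜 A] [StarModule 𝕜 A]

theorem exists_denseRange_inner_eq_star_mul {σ : StrongDual 𝕜 A}
    (hσ : ∀ x, σ (star x) = conj (σ x)) (hpos : ∀ x, 0 ≤ RCLike.re (σ (star x * x))) :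
    ∃ (H : Type u) (_ : NormedAddCommGroup H) (_ : InnerProductSpace 𝕜 H) (_ : CompleteSpace H)
      (Λ : A →ₗ[𝕜] H), DenseRange Λ ∧ ∀ x y, inner 𝕜 (Λ x) (Λ y) = σ (star x * y) :=
  exists_hilbertSpace_inner_eq
    { inner := fun x y => σ (star x * y)
      conj_inner_symm := fun x y => by rw [← hσ, star_mul, star_star]
      re_inner_nonneg := hpos
      add_left := fun x y z => by rw [star_add, add_mul, map_add]
      smul_left := fun x y r => by rw [star_smul, smul_mul_assoc, map_smul]; rfl }

variable [CStarRing A]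

theorem exists_gnsRepresentation [NormOneClass A] {σ : StrongDual 𝕜 A} (hσ1 : ‖σ‖ ≤ 1)
    (hσ : ∀ x, σ (star x) = conj (σ x)) (hpos : ∀ x, 0 ≤ RCLike.re (σ (star x * x))) :
    ∃ (H : Type u) (_ : NormedAddCommGroup H) (_ : InnerProductSpace 𝕜 H) (_ : CompleteSpace H)
      (π : A →⋆ₐ[𝕜] (H →L[𝕜] H)) (ξ : H), ‖ξ‖ ≤ 1 ∧ (DenseRange fun c => π c ξ) ∧
      ∀ c, ‖π c ξ‖ ^ 2 = RCLike.re (σ (star c * c)) := by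
  obtain ⟨H, _, _, _, Λ, hΛ, hinner⟩ := exists_denseRange_inner_eq_star_mul hσ hpos
  have hnorm : ∀ c, ‖Λ c‖ ^ 2 = RCLike.re (σ (star c * c)) := fun c => by
    rw [← inner_self_eq_norm_sq (𝕜 := 𝕜), hinner]
  have hle : ∀ c, ‖Λ c‖ ≤ 1 * ‖c‖ := fun c => by
    refine le_of_sq_le_sq ?_ (by positivity)
    calc ‖Λ c‖ ^ 2 ≤ ‖σ (star c * c)‖ := (hnorm c).trans_le (RCLike.re_le_norm _)
      _ ≤ 1 * ‖star c * c‖ := σ.le_of_opNorm_le hσ1 _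
      _ = (1 * ‖c‖) ^ 2 := by rw [CStarRing.norm_star_mul_self, one_mul, one_mul, sq]
  have hadj : ∀ a b c, inner 𝕜 (Λ (a * b)) (Λ c) = inner 𝕜 (Λ b) (Λ (star a * c)) :=
    fun a b c => by rw [hinner, hinner, star_mul, mul_assoc]
  have hbound : ∀ a, ∃ C, ∀ b, ‖Λ (a * b)‖ ≤ C * ‖Λ b‖ :=
    fun a => ⟨‖a‖, norm_map_mul_le hadj hle a⟩
  set π := inducedRepresentation hΛ hbound hadj
  have hπ : ∀ c, π c (Λ 1) = Λ c := fun c => by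
    rw [inducedRepresentation_apply, mul_one]
  refine ⟨H, _, _, _, π, Λ 1, by simpa using hle 1, ?_, fun c => ?_⟩
  · simpa only [hπ] using hΛ
  · rw [hπ, hnorm]

theorem exists_cyclicRepresentation_inner_eq [CompleteSpace A] [PositiveStarSquares A]
    {f : StrongDual 𝕜 A} (hf : ‖f‖ = 1) :
    ∃ (ρ : CyclicRepresentation.{u, v} 𝕜 A) (η : ρ.H), ‖η‖ = 1 ∧
      ∀ c, inner 𝕜 η (ρ.π c ρ.ξ) = f c := by
  have : Nontrivial A := not_subsingleton_iff_nontrivial.1 fun _ => by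
    simp [f.opNorm_subsingleton] at hf
  obtain ⟨σ, hσ1, hσ, hfσ⟩ := exists_hermitian_functional_dominating hf.le
  obtain ⟨H, _, _, _, π, ξ, hξ, hcyclic, hnorm⟩ :=
    exists_gnsRepresentation hσ1 hσ fun c => (sq_nonneg _).trans (hfσ c)
  obtain ⟨η, hη, hinner⟩ := exists_inner_eq_of_norm_le
    (Λ := (ContinuousLinearMap.apply 𝕜 H ξ).toLinearMap ∘ₗ π.toAlgHom.toLinearMap)
    hcyclic f.toLinearMap fun c => le_of_sq_le_sq ((hfσ c).trans_eq (hnorm c).symm) (norm_nonneg _)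
  have hprod : 1 ≤ ‖η‖ * ‖ξ‖ := hf.ge.trans <| f.opNorm_le_bound (by positivity) fun c => by
    calc ‖f c‖ = ‖inner 𝕜 η (π c ξ)‖ := congrArg _ (hinner c).symm
      _ ≤ ‖η‖ * ‖π c ξ‖ := norm_inner_le_norm _ _
      _ ≤ ‖η‖ * (‖c‖ * ‖ξ‖) := by
        gcongr
        exact (π c).le_of_opNorm_le (norm_starAlgHom_apply_le π c) ξ
      _ = ‖η‖ * ‖ξ‖ * ‖c‖ := by ring
  have hη1 : ‖η‖ = 1 := hη.antisymm (hprod.trans (mul_le_of_le_one_right (norm_nonneg _) hξ))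
  have hξ1 : ‖ξ‖ = 1 := hξ.antisymm (hprod.trans (mul_le_of_le_one_left (norm_nonneg _) hη))
  exact ⟨⟨H, π, ξ, hξ1, hcyclic⟩, η, hη1, hinner⟩

end Representation

end GelfandNaimarkSegal

section Distance

variable {𝕜 : Type v} [RCLike 𝕜]

theorem norm_comp_mkQL {E F : Type*} [SeminormedAddCommGroup E] [NormedSpace 𝕜 E]
    [SeminormedAddCommGroup F] [NormedSpace 𝕜 F] (B : Submodule 𝕜 E) (g : (E ⧸ B) →L[𝕜] F) :
    ‖g.comp B.mkQL‖ = ‖g‖ := by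
  refine le_antisymm ?_ (g.opNorm_le_bound (norm_nonneg _) fun y => ?_)
  · refine ContinuousLinearMap.opNorm_le_bound _ (norm_nonneg g) fun x => ?_
    exact (g.le_opNorm _).trans (by gcongr; exact Submodule.Quotient.norm_mk_le B x)
  · refine le_mul_of_forall_lt₀ fun M hM t ht => ?_
    obtain ⟨x, rfl, hx⟩ := Submodule.Quotient.norm_mk_lt y (sub_pos.2 ht)
    rw [add_sub_cancel] at hx
    exact (g.comp B.mkQL).le_of_opNorm_le_of_le hM.le hx.le

theorem exists_dual_vector_infDist {E : Type*} [NormedAddCommGroup E] [NormedSpace 𝕜 E]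
    {B : Submodule 𝕜 E} (hB : ¬ Dense (B : Set E)) (a : E) :
    ∃ f : StrongDual 𝕜 E, ‖f‖ = 1 ∧ (∀ b ∈ B, f b = 0) ∧
      f a = (Metric.infDist a (B : Set E) : ℝ) := by
  set C := B.topologicalClosure
  have : IsClosed (C : Set E) := B.isClosed_topologicalClosure
  have : Nontrivial (E ⧸ C) := Submodule.Quotient.nontrivial_iff.2 fun h =>
    hB (Submodule.dense_iff_topologicalClosure_eq_top.2 h)
  obtain ⟨g, hg, hga⟩ := exists_dual_vector' 𝕜 (C.mkQ a)
  refine ⟨g.comp C.mkQL, (norm_comp_mkQL C g).trans hg, fun b hb => ?_, hga.trans ?_⟩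
  · rw [ContinuousLinearMap.comp_apply, Submodule.mkQL_apply, Submodule.mkQ_apply,
      (Submodule.Quotient.mk_eq_zero C).2 (B.le_topologicalClosure hb), map_zero]
  · rw [← Metric.infDist_closure, ← Submodule.topologicalClosure_coe]
    exact congrArg _ (QuotientAddGroup.norm_mk (S := C.toAddSubgroup) a)

variable {A : Type u} [NormedRing A] [StarRing A] [CStarRing A] [CompleteSpace A]
  [NormedAlgebra 𝕜 A] [StarModule 𝕜 A] [PositiveStarSquares A]

theorem norm_inner_le_infDist (ρ : CyclicRepresentation 𝕜 A) {η : ρ.H}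
    (hη : ‖η‖ = 1) {B : Submodule 𝕜 A} (hηB : ∀ b ∈ B, inner 𝕜 η (ρ.π b ρ.ξ) = 0) (a : A) :
    ‖inner 𝕜 η (ρ.π a ρ.ξ)‖ ≤ Metric.infDist a (B : Set A) := by
  refine (Metric.le_infDist B.nonempty).2 fun b hb => ?_
  calc ‖inner 𝕜 η (ρ.π a ρ.ξ)‖ = ‖inner 𝕜 η (ρ.π (a - b) ρ.ξ)‖ := by
        rw [map_sub, sub_apply, inner_sub_right, hηB b hb, sub_zero]
    _ ≤ ‖η‖ * ‖ρ.π (a - b) ρ.ξ‖ := norm_inner_le_norm _ _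
    _ ≤ 1 * (‖a - b‖ * 1) := by
        gcongr
        · exact hη.le
        · exact (ρ.π (a - b)).le_of_opNorm_le_of_le (norm_starAlgHom_apply_le ρ.π _) ρ.norm_ξ.le
    _ = dist a b := by rw [one_mul, mul_one, dist_eq_norm]

end Distance

theorem mainTheorem5_general {𝕜 : Type v} {A : Type u} [RCLike 𝕜] [NormedRing A] [StarRing A]
    [CStarRing A] [CompleteSpace A] [NormedAlgebra 𝕜 A] [StarModule 𝕜 A] [PositiveStarSquares A]
    (a : A) (B : Submodule 𝕜 A) (hB : ¬ Dense (B : Set A)) :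
    IsGreatest
      {r : ℝ | ∃ (ρ : CyclicRepresentation.{u, v} 𝕜 A) (η : ρ.H), ‖η‖ = 1 ∧
        (∀ b ∈ B, inner 𝕜 η (ρ.π b ρ.ξ) = 0) ∧ r = ‖inner 𝕜 η (ρ.π a ρ.ξ)‖}
      (Metric.infDist a (B : Set A)) := by
  refine ⟨?_, ?_⟩
  · obtain ⟨f, hf, hfB, hfa⟩ := exists_dual_vector_infDist hB a
    obtain ⟨ρ, η, hη, hinner⟩ := exists_cyclicRepresentation_inner_eq hf
    refine ⟨ρ, η, hη, fun b hb => (hinner b).trans (hfB b hb), ?_⟩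
    rw [hinner, hfa, RCLike.norm_of_nonneg Metric.infDist_nonneg]
  · rintro _ ⟨ρ, η, hη, hηB, rfl⟩
    exact norm_inner_le_infDist ρ hη hηB a

/-- Mathlib's inner product is conjugate linear in its first argument, so `⟨π(a)ξ | η⟩`, linear in
`π(a)ξ`, is `inner 𝕜 η (π a ξ)`. -/
theorem mainTheorem5 {𝕜 : Type v} {A : Type u} [RCLike 𝕜] [NormedRing A] [StarRing A]
    [CStarRing A] [CompleteSpace A] [NormedAlgebra 𝕜 A] [StarModule 𝕜 A] [PositiveStarSquares A]
    (a : A) (B : Submodule 𝕜 A) (hB : ¬ Dense (B : Set A))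
    (hbest : ∃ b₀ : A, IsBestApproximation a B b₀) :
    IsGreatest
      {r : ℝ | ∃ (ρ : CyclicRepresentation.{u, v} 𝕜 A) (η : ρ.H), ‖η‖ = 1 ∧
        (∀ b ∈ B, inner 𝕜 η (ρ.π b ρ.ξ) = 0) ∧ r = ‖inner 𝕜 η (ρ.π a ρ.ξ)‖}
      (Metric.infDist a (B : Set A)) :=
  mainTheorem5_general a B hB
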